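/- A smocking pattern in $\mathbb{E}^N$ is a finite or countable collection $\mathcal I$ of pairwise disjoint, connected, compact subsets of $\mathbb{E}^N$ (the stitches) for which there is a $\delta>0$ such that points in distinct stitches are at Euclidean distance at least $\delta$. Its smocking set is $S=\bigcup_{I\in\mathcal I} I$. The smocked space $X$ is obtained from $\mathbb{E}^N$ by identifying each stitch to a point; $\pi:\mathbb{E}^N\to X$ is the quotient map, and the metric is $$d(x,y)=\inf\Big\{|v-z_1|+\sum_{i=1}^{m-1}|z_i'-z_{i+1}|+|z_m'-w|\Big\},$$ the infimum over all $m\ge 0$, all $v\in\pi^{-1}(x)$, $w\in\pi^{-1}(y)$, and all $z_i,z_i'\in I_i\in\mathcal I$ with $I_i\ne I_{i+1}$ (for $m=0$ the length is $|v-w|$). The space is equipped with the measure $\mu=\pi_\#\mathcal L^N$ and the base point $\pi(0)$. Corollary. Let $\mathcal I_k$ ($k\in\mathbb N$) and $\mathcal I_\infty$ be smocking patterns in $\mathbb{E}^N$, with smocking sets $S_k,S_\infty$ and pointed smocked metric measure spaces $(X_k,d_k,\mu_k,x_k)$, $(X_\infty,d_\infty,\mu_\infty,x_\infty)$. Assume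 that $S_k\to S_\infty$ in the Hausdorff distance, either globally, that is $d_H(S_k,S_\infty)\to 0$, or locally, that is, for every $R>0$, $$d_H\Big(\bigcup\{I\in\mathcal I_k: I\cap\overline{B_R(0)}\neq\varnothing\},\ \bigcup\{I\in\mathcal I_\infty: I\cap\overline{B_R(0)}\neq\varnothing\}\Big)\to 0$$ (with $d_H(\varnothing,\varnothing)=0$ and $d_H(\varnothing,A)=\infty$ for $A\ne\varnothing$). Assume moreover that the smocking constants are locally uniformly bounded: for every $R>0$ there are $L_R<\infty$, $\delta_R>0$ and $K_R$ such that for all $k\ge K_R$ every stitch in $\mathcal I_k$ meeting $\overline{B_R(0)}$ has diameter at most $L_R$, and distinct such stitches are at distance at least $\delta_R$ from each other. Then $$(X_k,d_k,\mu_k,x_k)\xrightarrow{\mathrm{pmGH}}(X_\infty,d_\infty,\mu_\infty,x_\infty).$$ That is: balls have finite measure in all these spaces, and there are $R_k\to\infty$, $\varepsilon_k>0$ with $\varepsilon_k\to0$, and Borel maps $f_k:X_k\to X_\infty$ with $f_k(x_k)=x_\infty$ such that $|d_\infty(f_k(a),f_k(b))-d_k(a,b)|\le\varepsilon_k$ for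 all $a,b\in B_{R_k}(x_k)$, the ball $B_{R_k-\varepsilon_k}(x_\infty)$ is contained in the $\varepsilon_k$-neighbourhood of $f_k(B_{R_k}(x_k))$, and $$\int_{B_{R_k}(x_k)}\varphi\circ f_k\,d\mu_k\to\int_{X_\infty}\varphi\,d\mu_\infty$$ for every bounded continuous $\varphi:X_\infty\to\mathbb R$ with bounded support. -/

import Mathlib

open Filter Topology MeasureTheory

noncomputable section

/-- A smocking pattern in Euclidean space `𝔼ᴺ`: a finite or countable collection of pairwise
disjoint, connected (hence nonempty), compact sets, the stitches, with a positive separation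
factor: distinct stitches are at distance at least some `δ > 0` from each other. -/
structure SmockingPattern (N : ℕ) where
  stitches : Set (Set (EuclideanSpace ℝ (Fin N)))
  countable : stitches.Countable
  isConnected : ∀ I ∈ stitches, IsConnected I
  isCompact : ∀ I ∈ stitches, IsCompact I
  disjoint : stitches.PairwiseDisjoint id
  separated : ∃ δ : ℝ, 0 < δ ∧ ∀ I ∈ stitches, ∀ I' ∈ stitches, I ≠ I' →
    ∀ z ∈ I, ∀ z' ∈ I', δ ≤ dist z z'

namespace SmockingPattern

variable {N : ℕ} (P : SmockingPattern N)

/-- The smocking set: the union of all stitches. -/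
def smockingSet : Set (EuclideanSpace ℝ (Fin N)) := ⋃₀ P.stitches

/-- The stitches that meet the closed Euclidean ball of radius `R` about the origin. -/
def stitchesMeeting (R : ℝ) : Set (Set (EuclideanSpace ℝ (Fin N))) :=
  {I ∈ P.stitches | (I ∩ Metric.closedBall 0 R).Nonempty}

/-- Two points are identified when they are equal or lie in a common stitch. -/
def Rel (v w : EuclideanSpace ℝ (Fin N)) : Prop :=
  v = w ∨ ∃ I ∈ P.stitches, v ∈ I ∧ w ∈ I

theorem eq_of_mem {I I' : Set (EuclideanSpace ℝ (Fin N))} (hI : I ∈ P.stitches)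
    (hI' : I' ∈ P.stitches) {v : EuclideanSpace ℝ (Fin N)} (h : v ∈ I) (h' : v ∈ I') :
    I = I' := by
  by_contra hne
  exact Set.disjoint_left.1 (P.disjoint hI hI' hne) h h'

def setoid : Setoid (EuclideanSpace ℝ (Fin N)) where
  r := P.Rel
  iseqv :=
    { refl := fun _ => Or.inl rfl
      symm := by
        rintro v w (rfl | ⟨I, hI, hv, hw⟩)
        · exact Or.inl rfl
        · exact Or.inr ⟨I, hI, hw, hv⟩
      trans := by
        rintro u v w (rfl | ⟨I, hI, hu, hv⟩) (rfl | ⟨I', hI', hv', hw⟩)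
        · exact Or.inl rfl
        · exact Or.inr ⟨I', hI', hv', hw⟩
        · exact Or.inr ⟨I, hI, hu, hv⟩
        · obtain rfl := P.eq_of_mem hI hI' hv hv'
          exact Or.inr ⟨I, hI, hu, hw⟩ }

/-- The smocked space: Euclidean space with every stitch collapsed to a point. -/
def Space : Type := Quotient P.setoid

/-- The smocking map `π : 𝔼ᴺ → X`. -/
def proj (v : EuclideanSpace ℝ (Fin N)) : P.Space := Quotient.mk P.setoid v

theorem proj_eq_iff {v w : EuclideanSpace ℝ (Fin N)} : P.proj v = P.proj w ↔ P.Rel v w :=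
  Quotient.eq (r := P.setoid)

theorem exists_rep (x : P.Space) : ∃ v, P.proj v = x := Quotient.exists_rep x

/-- One passage through a stitch: the stitch, the point of entry, the point of exit. -/
abbrev Hop (N : ℕ) : Type :=
  Set (EuclideanSpace ℝ (Fin N)) × EuclideanSpace ℝ (Fin N) × EuclideanSpace ℝ (Fin N)

/-- The total length `|v - z₁| + ∑ |z'ᵢ - zᵢ₊₁| + |z'ₖ - w|` of the segments that lead from `v`
to `w` through the listed stitches. -/
def chainLength (w : EuclideanSpace ℝ (Fin N)) :
    EuclideanSpace ℝ (Fin N) → List (Hop N) → ℝ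
  | v, [] => dist v w
  | v, h :: l => dist v h.2.1 + chainLength w h.2.2 l

/-- A list of hops `(I_{jᵢ}, zᵢ, z'ᵢ)` with `zᵢ, z'ᵢ ∈ I_{jᵢ}` and `j₁ ≠ j₂ ≠ ⋯ ≠ jₖ`. -/
def IsHopChain (l : List (Hop N)) : Prop :=
  (∀ h ∈ l, h.1 ∈ P.stitches ∧ h.2.1 ∈ h.1 ∧ h.2.2 ∈ h.1) ∧
    l.IsChain (fun h h' => h.1 ≠ h'.1)

/-- The lengths of all chains from a lift of `x` to a lift of `y`. -/
def chainLengths (x y : P.Space) : Set ℝ :=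
  {ℓ | ∃ v w : EuclideanSpace ℝ (Fin N), P.proj v = x ∧ P.proj w = y ∧
    ∃ l : List (Hop N), P.IsHopChain l ∧ ℓ = chainLength w v l}

/-- The smocked distance. -/
def smockedDist (x y : P.Space) : ℝ := sInf (P.chainLengths x y)

theorem chainLength_nonneg (w : EuclideanSpace ℝ (Fin N)) (l : List (Hop N)) :
    ∀ v, 0 ≤ chainLength w v l := by
  induction l with
  | nil => intro v; exact dist_nonneg
  | cons h l ih => intro v; exact add_nonneg dist_nonneg (ih _)

theorem bddBelow_chainLengths (x y : P.Space) : BddBelow (P.chainLengths x y) := by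
  refine ⟨0, ?_⟩
  rintro ℓ ⟨v, w, -, -, l, -, rfl⟩
  exact chainLength_nonneg w l v

theorem chainLengths_nonempty (x y : P.Space) : (P.chainLengths x y).Nonempty := by
  obtain ⟨v, rfl⟩ := P.exists_rep x
  obtain ⟨w, rfl⟩ := P.exists_rep y
  exact ⟨_, v, w, rfl, rfl, [], ⟨by simp, by simp⟩, rfl⟩

theorem chainLength_le_dist_add (w : EuclideanSpace ℝ (Fin N)) (l : List (Hop N))
    (u v : EuclideanSpace ℝ (Fin N)) :
    chainLength w u l ≤ dist u v + chainLength w v l := by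
  cases l with
  | nil => exact dist_triangle u v w
  | cons h l =>
    have := dist_triangle u v h.2.1
    simp only [chainLength]; linarith

theorem chainLength_append (w u : EuclideanSpace ℝ (Fin N)) (l' : List (Hop N))
    (l : List (Hop N)) :
    ∀ v, chainLength w v (l ++ l') ≤ chainLength u v l + chainLength w u l' := by
  induction l with
  | nil => intro v; exact chainLength_le_dist_add w l' v u
  | cons h l ih =>
    intro v
    have := ih h.2.2
    simp only [List.cons_append, chainLength]; linarith

/-- Consecutive hops through the same stitch can be merged without increasing the length. -/
theorem exists_isHopChain (w : EuclideanSpace ℝ (Fin N)) (l : List (Hop N)) :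
    (∀ h ∈ l, h.1 ∈ P.stitches ∧ h.2.1 ∈ h.1 ∧ h.2.2 ∈ h.1) → ∀ v,
      ∃ l', P.IsHopChain l' ∧ chainLength w v l' ≤ chainLength w v l := by
  induction l with
  | nil => intro _ v; exact ⟨[], ⟨by simp, by simp⟩, le_rfl⟩
  | cons h l ih =>
    intro hl v
    obtain ⟨l', hl', hle⟩ := ih (fun g hg => hl g (List.mem_cons_of_mem _ hg)) h.2.2
    have hh := hl h (by simp)
    cases l' with
    | nil =>
      refine ⟨[h], ⟨by simpa using hh, by simp⟩, ?_⟩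
      simp only [chainLength] at hle ⊢; linarith
    | cons g l'' =>
      obtain ⟨h1, h2⟩ := hl'
      by_cases hg : h.1 = g.1
      · refine ⟨(g.1, h.2.1, g.2.2) :: l'', ⟨?_, ?_⟩, ?_⟩
        · intro a ha
          rcases List.mem_cons.1 ha with rfl | ha
          · have := h1 g (by simp)
            exact ⟨this.1, hg ▸ hh.2.1, this.2.2⟩
          · exact h1 a (List.mem_cons_of_mem _ ha)
        · cases l'' with
          | nil => simp
          | cons b l3 => simpa using h2
        · have : (0 : ℝ) ≤ dist h.2.2 g.2.1 := dist_nonneg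
          simp only [chainLength] at hle ⊢; linarith
      · refine ⟨h :: g :: l'', ⟨?_, ?_⟩, ?_⟩
        · intro a ha
          rcases List.mem_cons.1 ha with rfl | ha
          · exact hh
          · exact h1 a ha
        · simpa using ⟨hg, by simpa using h2⟩
        · simp only [chainLength] at hle ⊢; linarith

theorem smockedDist_le (v w : EuclideanSpace ℝ (Fin N)) (l : List (Hop N))
    (hl : ∀ h ∈ l, h.1 ∈ P.stitches ∧ h.2.1 ∈ h.1 ∧ h.2.2 ∈ h.1) :
    P.smockedDist (P.proj v) (P.proj w) ≤ chainLength w v l := by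
  obtain ⟨l', hl', hle⟩ := P.exists_isHopChain w l hl v
  exact (csInf_le (P.bddBelow_chainLengths _ _) ⟨v, w, rfl, rfl, l', hl', rfl⟩).trans hle

theorem smockedDist_nonneg (x y : P.Space) : 0 ≤ P.smockedDist x y := by
  refine le_csInf (P.chainLengths_nonempty x y) ?_
  rintro ℓ ⟨v, w, -, -, l, -, rfl⟩
  exact chainLength_nonneg w l v

theorem smockedDist_self (x : P.Space) : P.smockedDist x x = 0 := by
  obtain ⟨v, rfl⟩ := P.exists_rep x
  refine le_antisymm ?_ (P.smockedDist_nonneg _ _)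
  simpa [chainLength] using P.smockedDist_le v v [] (by simp)

/-- Traversing a chain backwards. -/
def revHops (l : List (Hop N)) : List (Hop N) := (l.map fun h => (h.1, h.2.2, h.2.1)).reverse

theorem chainLength_revHops (w : EuclideanSpace ℝ (Fin N)) (l : List (Hop N)) :
    ∀ v, chainLength v w (revHops l) ≤ chainLength w v l := by
  induction l with
  | nil => intro v; simp [revHops, chainLength, dist_comm]
  | cons h l ih =>
    intro v
    have e : revHops (h :: l) = revHops l ++ [(h.1, h.2.2, h.2.1)] := by simp [revHops]
    rw [e]
    have h1 := chainLength_append v h.2.2 [(h.1, h.2.2, h.2.1)] (revHops l) w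
    have h2 := ih h.2.2
    simp only [chainLength, dist_self, zero_add] at h1 ⊢
    rw [dist_comm v]; linarith

theorem smockedDist_comm_le (x y : P.Space) : P.smockedDist y x ≤ P.smockedDist x y := by
  refine le_csInf (P.chainLengths_nonempty x y) ?_
  rintro ℓ ⟨v, w, rfl, rfl, l, hl, rfl⟩
  refine (P.smockedDist_le w v (revHops l) ?_).trans (chainLength_revHops w l v)
  intro h hh
  simp only [revHops, List.mem_reverse, List.mem_map] at hh
  obtain ⟨g, hg, rfl⟩ := hh
  have := hl.1 g hg
  exact ⟨this.1, this.2.2, this.2.1⟩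

theorem smockedDist_triangle (x y z : P.Space) :
    P.smockedDist x z ≤ P.smockedDist x y + P.smockedDist y z := by
  rw [← sub_le_iff_le_add]
  refine le_csInf (P.chainLengths_nonempty x y) ?_
  rintro ℓ ⟨u, v, rfl, rfl, l, hl, rfl⟩
  rw [sub_le_comm]
  refine le_csInf (P.chainLengths_nonempty _ z) ?_
  rintro ℓ ⟨v', w, hv', rfl, l', hl', rfl⟩
  have hv := hv'.symm
  rw [sub_le_iff_le_add']
  rcases P.proj_eq_iff.1 hv with rfl | ⟨I, hI, h1, h2⟩
  · refine (P.smockedDist_le u w (l ++ l') ?_).trans (chainLength_append w v l' l u)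
    intro h hh
    rcases List.mem_append.1 hh with hh | hh
    · exact hl.1 h hh
    · exact hl'.1 h hh
  · have key := chainLength_append w v ((I, v, v') :: l') l u
    simp only [chainLength, dist_self, zero_add] at key
    refine (P.smockedDist_le u w (l ++ (I, v, v') :: l') ?_).trans key
    intro h hh
    rcases List.mem_append.1 hh with hh | hh
    · exact hl.1 h hh
    · rcases List.mem_cons.1 hh with rfl | hh
      · exact ⟨hI, h1, h2⟩
      · exact hl'.1 h hh

/-- A fibre of the smocking map is at positive distance from all the other stitches. -/
theorem exists_gap (v : EuclideanSpace ℝ (Fin N)) : ∃ c : ℝ, 0 < c ∧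
    ∀ I ∈ P.stitches, v ∉ I → ∀ z ∈ I, ∀ a, P.Rel a v → c ≤ dist a z := by
  obtain ⟨δ, hδ, hsep⟩ := P.separated
  by_cases hv : ∃ I₀ ∈ P.stitches, v ∈ I₀
  · obtain ⟨I₀, hI₀, hv₀⟩ := hv
    refine ⟨δ, hδ, fun I hI hvI z hz a ha => ?_⟩
    have ha₀ : a ∈ I₀ := by
      rcases ha with rfl | ⟨I₁, hI₁, h1, h2⟩
      · exact hv₀
      · exact P.eq_of_mem hI₁ hI₀ h2 hv₀ ▸ h1
    exact hsep I₀ hI₀ I hI (by rintro rfl; exact hvI hv₀) a ha₀ z hz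
  · push Not at hv
    have hrel : ∀ a, P.Rel a v → a = v := by
      rintro a (h | ⟨I, hI, -, h⟩)
      · exact h
      · exact (hv I hI h).elim
    by_cases hn : ∃ I₀ ∈ P.stitches, ∃ z₀ ∈ I₀, dist v z₀ < δ / 2
    · obtain ⟨I₀, hI₀, z₀, hz₀, hd⟩ := hn
      have hpos : 0 < Metric.infDist v I₀ :=
        ((P.isCompact I₀ hI₀).isClosed.notMem_iff_infDist_pos ⟨z₀, hz₀⟩).1 (hv I₀ hI₀)
      refine ⟨min (δ / 2) (Metric.infDist v I₀), lt_min (by positivity) hpos, ?_⟩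
      intro I hI _ z hz a ha
      obtain rfl := hrel a ha
      by_cases hII : I = I₀
      · subst hII
        exact (min_le_right _ _).trans (Metric.infDist_le_dist_of_mem hz)
      · refine (min_le_left _ _).trans ?_
        have h1 := hsep I hI I₀ hI₀ hII z hz z₀ hz₀
        have h2 := dist_triangle z a z₀
        rw [dist_comm z a] at h2
        linarith
    · push Not at hn
      refine ⟨δ / 2, by positivity, fun I hI _ z hz a ha => ?_⟩
      obtain rfl := hrel a ha
      exact hn I hI z hz

theorem eq_of_smockedDist_eq_zero {x y : P.Space} (h0 : P.smockedDist x y = 0) : x = y := by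
  by_contra hne
  obtain ⟨v, rfl⟩ := P.exists_rep x
  obtain ⟨w, rfl⟩ := P.exists_rep y
  obtain ⟨δ, hδ, hsep⟩ := P.separated
  obtain ⟨cv, hcv, hv⟩ := P.exists_gap v
  obtain ⟨cw, hcw, hw⟩ := P.exists_gap w
  have hvw : 0 < dist v w := dist_pos.2 (fun h => hne (h ▸ rfl))
  have hnot : ∀ I ∈ P.stitches, v ∈ I → w ∉ I := fun I hI h1 h2 =>
    hne (P.proj_eq_iff.2 (Or.inr ⟨I, hI, h1, h2⟩))
  have hlow : min (min cv cw) (min δ (dist v w)) ≤ P.smockedDist (P.proj v) (P.proj w) := by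
    refine le_csInf (P.chainLengths_nonempty _ _) ?_
    rintro ℓ ⟨v', w', hv', hw', l, hl, rfl⟩
    rw [P.proj_eq_iff] at hv' hw'
    cases l with
    | nil =>
      simp only [chainLength]
      rcases hv' with rfl | ⟨I, hI, h1, h2⟩
      · rcases hw' with rfl | ⟨I, hI, h1, h2⟩
        · exact (min_le_right _ _).trans (min_le_right _ _)
        · refine ((min_le_left _ _).trans (min_le_left _ _)).trans ?_
          exact hv I hI (fun h => hnot I hI h h2) w' h1 v' (Or.inl rfl)
      · refine ((min_le_left _ _).trans (min_le_right _ _)).trans ?_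
        rw [dist_comm]
        exact hw I hI (hnot I hI h2) v' h1 w' hw'
    | cons g l =>
      have hg := hl.1 g (by simp)
      simp only [chainLength]
      by_cases hvg : v ∈ g.1
      · have hnn : (0 : ℝ) ≤ dist v' g.2.1 := dist_nonneg
        cases l with
        | nil =>
          simp only [chainLength]
          have := hw g.1 hg.1 (hnot _ hg.1 hvg) g.2.2 hg.2.2 w' hw'
          rw [dist_comm] at this
          have h3 := (min_le_left (min cv cw) (min δ (dist v w))).trans (min_le_right _ _)
          linarith
        | cons b l =>
          simp only [chainLength]
          have hb := hl.1 b (by simp)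
          have hgb : g.1 ≠ b.1 := (List.isChain_cons_cons.1 hl.2).1
          have := hsep g.1 hg.1 b.1 hb.1 hgb g.2.2 hg.2.2 b.2.1 hb.2.1
          have h3 := (min_le_right (min cv cw) (min δ (dist v w))).trans (min_le_left _ _)
          have h4 := chainLength_nonneg w' l b.2.2
          linarith
      · have := hv g.1 hg.1 hvg g.2.1 hg.2.1 v' hv'
        have h3 := (min_le_left (min cv cw) (min δ (dist v w))).trans (min_le_left _ _)
        have h4 := chainLength_nonneg w' l g.2.2
        linarith
  rw [h0] at hlow
  exact absurd hlow (not_le.2 (lt_min (lt_min hcv hcw) (lt_min hδ hvw)))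

/-- The smocked space is a metric space for the smocked distance. -/
instance : MetricSpace P.Space where
  dist := P.smockedDist
  dist_self := P.smockedDist_self
  dist_comm x y := le_antisymm (P.smockedDist_comm_le y x) (P.smockedDist_comm_le x y)
  dist_triangle := P.smockedDist_triangle
  eq_of_dist_eq_zero := P.eq_of_smockedDist_eq_zero

instance : MeasurableSpace P.Space := borel P.Space

instance : BorelSpace P.Space := ⟨rfl⟩

theorem measurable_proj : Measurable P.proj := by
  have h : LipschitzWith 1 P.proj := LipschitzWith.of_dist_le_mul fun v w => by
    rw [NNReal.coe_one, one_mul]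
    exact P.smockedDist_le v w [] (by simp)
  exact h.continuous.measurable

/-- The measure of the smocked space: the pushforward of Lebesgue measure under the
(measurable) smocking map. -/
def measure : Measure P.Space := Measure.map P.proj volume

/-- The base point of the smocked space: the image of the origin. -/
def basePoint : P.Space := P.proj 0

end SmockingPattern

/-- Pointed measured Gromov-Hausdorff convergence of pointed metric measure spaces
`(X k, μ k, x k)` whose balls have finite measure to such a space `(Y, ν, y)`. There are radii
`R k → ∞`, errors `ε k → 0` and Borel maps `f k`, considered on the balls `B(x k, R k)`, that
preserve the base points, distort distances by at most `ε k`, have images that are `ε k`-dense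
in `B(y, R k - ε k)`, and for which the pushforwards of the measures `μ k` restricted to
`B(x k, R k)` converge to `ν` when tested against the bounded continuous functions with bounded
support. -/
def PointedMeasuredGHTendsto {X : ℕ → Type*} [∀ k, MetricSpace (X k)]
    [∀ k, MeasurableSpace (X k)] (μ : ∀ k, Measure (X k)) (x : ∀ k, X k)
    {Y : Type*} [MetricSpace Y] [MeasurableSpace Y] (ν : Measure Y) (y : Y) : Prop :=
  (∀ k r, μ k (Metric.ball (x k) r) < ⊤) ∧ (∀ r, ν (Metric.ball y r) < ⊤) ∧
  ∃ (R ε : ℕ → ℝ) (f : ∀ k, X k → Y),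
    Tendsto R atTop atTop ∧ (∀ k, 0 < ε k) ∧ Tendsto ε atTop (𝓝 0) ∧
    (∀ k, Measurable (f k)) ∧
    (∀ k, f k (x k) = y) ∧
    (∀ k, ∀ a ∈ Metric.ball (x k) (R k), ∀ b ∈ Metric.ball (x k) (R k),
      |dist (f k a) (f k b) - dist a b| ≤ ε k) ∧
    (∀ k, Metric.ball y (R k - ε k) ⊆
      Metric.thickening (ε k) (f k '' Metric.ball (x k) (R k))) ∧
    ∀ φ : Y → ℝ, Continuous φ → (∃ C, ∀ p, |φ p| ≤ C) →
      Bornology.IsBounded (Function.support φ) →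
      Tendsto (fun k => ∫ a in Metric.ball (x k) (R k), φ (f k a) ∂(μ k)) atTop
        (𝓝 (∫ p, φ p ∂ν))

/-- Convergence of the smocking sets in the Hausdorff distance of `𝔼ᴺ`. -/
def HausdorffTendsto {N : ℕ} (P : ℕ → SmockingPattern N) (Q : SmockingPattern N) : Prop :=
  Tendsto (fun k => Metric.hausdorffEDist (P k).smockingSet Q.smockingSet) atTop (𝓝 0)

/-- Local Hausdorff convergence: for every `R > 0` the unions of the stitches that meet the closed
ball of radius `R` converge in the Hausdorff distance. -/
def LocallyHausdorffTendsto {N : ℕ} (P : ℕ → SmockingPattern N) (Q : SmockingPattern N) : Prop :=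
  ∀ R : ℝ, 0 < R →
    Tendsto (fun k => Metric.hausdorffEDist (⋃₀ (P k).stitchesMeeting R) (⋃₀ Q.stitchesMeeting R))
      atTop (𝓝 0)

/-- Local uniform bounds on the smocking constants: for every `R > 0` there are `L < ∞` and
`δ > 0` such that for all large `k` the stitches that meet the closed ball of radius `R` have
diameter at most `L`, and distinct ones are at distance at least `δ` from each other. -/
def LocalUniformBounds {N : ℕ} (P : ℕ → SmockingPattern N) : Prop :=
  ∀ R : ℝ, 0 < R → ∃ L δ : ℝ, 0 < δ ∧ ∃ K : ℕ, ∀ k ≥ K,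
    (∀ I ∈ (P k).stitchesMeeting R, Metric.diam I ≤ L) ∧
    ∀ I ∈ (P k).stitchesMeeting R, ∀ I' ∈ (P k).stitchesMeeting R, I ≠ I' →
      ∀ z ∈ I, ∀ z' ∈ I', δ ≤ dist z z'

end

/-!
By connectedness and local separation, if two smocking sets are close within a ball then each stitch
of the one that meets a smaller ball lies near a single stitch of the other. A chain through the
stitches of the first pattern can then be followed through those of the second, at the cost of a
small error per stitch. Since the gap before each further stitch has length at least the separation
factor, these errors amount to a small multiple of the length of the chain. Applied in both
directions, this shows that the smocked distances, pulled back to Euclidean space, converge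
uniformly on bounded sets, and that the smocking maps are uniformly proper.

The approximations compose a section of the smocking map `𝔼ᴺ → X k` with the limiting smocking map.
A section is Borel because only the countably many stitches leave it a choice. Pulled back to `𝔼ᴺ`,
the integrals in question are integrals of functions with common bounded support that converge
pointwise, so dominated convergence applies.
-/

section PulledBackDistances

open Metric Bornology Set

variable {ι E Y : Type*} {X : ι → Type*} [PseudoMetricSpace E] [∀ i, PseudoMetricSpace (X i)]
  [PseudoMetricSpace Y] {l : Filter ι} {π : ∀ i, E → X i} {p : E → Y} {s : ∀ i, X i → E} {o : E}

/-- The distances pulled back along `π i` converge to the distance pulled back along `p`,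
uniformly on bounded subsets of `E`. -/
def PullbackDistTendsto (l : Filter ι) (π : ∀ i, E → X i) (p : E → Y) : Prop :=
  ∀ B : Set E, IsBounded B →
    TendstoUniformlyOn (fun i z => dist (π i z.1) (π i z.2)) (fun z => dist (p z.1) (p z.2)) l
      (B ×ˢ B)

/-- Properness of a family of maps, uniform for almost all indices: the preimages of the balls of
a given radius about the images of `o` lie in a common ball about `o`. -/
def UniformlyProper (l : Filter ι) (π : ∀ i, E → X i) (o : E) : Prop :=
  ∀ r : ℝ, ∃ R : ℝ, ∀ᶠ i in l, π i ⁻¹' ball (π i o) r ⊆ closedBall o R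

theorem PullbackDistTendsto.eventually_abs_sub_lt (h : PullbackDistTendsto l π p) {B : Set E}
    (hB : IsBounded B) {ε : ℝ} (hε : 0 < ε) :
    ∀ᶠ i in l, ∀ v ∈ B, ∀ w ∈ B, |dist (p v) (p w) - dist (π i v) (π i w)| < ε := by
  filter_upwards [tendstoUniformlyOn_iff.1 (h B hB) ε hε] with i hi v hv w hw
  exact hi (v, w) ⟨hv, hw⟩

theorem PullbackDistTendsto.tendsto_dist (h : PullbackDistTendsto l π p) (v w : E) :
    Tendsto (fun i => dist (π i v) (π i w)) l (𝓝 (dist (p v) (p w))) :=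
  (h {v, w} (toFinite _).isBounded).tendsto_at (x := (v, w)) (by simp)

theorem eventually_section_mem_closedBall (hprop : UniformlyProper l π o)
    (hs : ∀ i, Function.RightInverse (s i) (π i)) (r : ℝ) :
    ∃ R, ∀ᶠ i in l, ∀ a ∈ ball (π i o) r, s i a ∈ closedBall o R := by
  obtain ⟨R, hR⟩ := hprop r
  refine ⟨R, ?_⟩
  filter_upwards [hR] with i hi a ha
  exact hi (by rwa [mem_preimage, hs i a])

theorem eventually_abs_dist_section_sub_lt (hdist : PullbackDistTendsto l π p)
    (hprop : UniformlyProper l π o) (hs : ∀ i, Function.RightInverse (s i) (π i)) (r : ℝ) {ε : ℝ}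
    (hε : 0 < ε) :
    ∀ᶠ i in l, ∀ a ∈ ball (π i o) r, ∀ b ∈ ball (π i o) r,
      |dist (p (s i a)) (p (s i b)) - dist a b| < ε := by
  obtain ⟨R, hR⟩ := eventually_section_mem_closedBall hprop hs r
  filter_upwards [hR, hdist.eventually_abs_sub_lt isBounded_closedBall hε] with i hi hd a ha b hb
  simpa only [hs i a, hs i b] using hd _ (hi a ha) _ (hi b hb)

theorem eventually_ball_subset_thickening_image_section (hdist : PullbackDistTendsto l π p)
    (hprop : UniformlyProper l π o) (hs : ∀ i, Function.RightInverse (s i) (π i))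
    (hp : Function.Surjective p) (hpb : ∀ r, IsBounded (p ⁻¹' ball (p o) r)) (r : ℝ) {ε : ℝ}
    (hε : 0 < ε) :
    ∀ᶠ i in l, ball (p o) (r - ε) ⊆ thickening ε ((fun a => p (s i a)) '' ball (π i o) r) := by
  obtain ⟨R, hR⟩ := eventually_section_mem_closedBall hprop hs r
  set B := insert o (p ⁻¹' ball (p o) (r - ε)) ∪ closedBall o R
  have hB : IsBounded B := ((hpb _).insert o).union isBounded_closedBall
  filter_upwards [hR, hdist.eventually_abs_sub_lt hB hε] with i hi hd y hy
  obtain ⟨v, rfl⟩ := hp y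
  have hv : π i v ∈ ball (π i o) r := by
    have hvo := hd v (Or.inl (Or.inr hy)) o (Or.inl (Or.inl rfl))
    rw [mem_ball] at hy ⊢
    linarith [neg_lt_of_abs_lt hvo]
  have hvs := hd v (Or.inl (Or.inr hy)) _ (Or.inr (hi _ hv))
  rw [hs, dist_self, sub_zero, abs_of_nonneg dist_nonneg] at hvs
  exact mem_thickening_iff.2 ⟨_, mem_image_of_mem _ hv, hvs⟩

theorem tendsto_section (hdist : PullbackDistTendsto l π p) (hprop : UniformlyProper l π o)
    (hs : ∀ i, Function.RightInverse (s i) (π i)) (v : E) :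
    Tendsto (fun i => p (s i (π i v))) l (𝓝 (p v)) := by
  obtain ⟨R, hR⟩ := eventually_section_mem_closedBall hprop hs (dist (p v) (p o) + 1)
  have hvo := (hdist.tendsto_dist v o).eventually_lt_const (lt_add_one _)
  refine Metric.tendsto_nhds.2 fun ε hε => ?_
  filter_upwards [hR, hvo, hdist.eventually_abs_sub_lt (isBounded_closedBall.insert v) hε]
    with i hi hvo hd
  have hsv := hd _ (mem_insert_of_mem v (hi _ hvo)) v (mem_insert _ _)
  rwa [hs, dist_self, sub_zero, abs_of_nonneg dist_nonneg] at hsv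

theorem exists_eventually_section_mem_imp_mem_closedBall (hdist : PullbackDistTendsto l π p)
    (hprop : UniformlyProper l π o) (hs : ∀ i, Function.RightInverse (s i) (π i))
    (hpb : ∀ r, IsBounded (p ⁻¹' ball (p o) r)) (r : ℝ) :
    ∃ R, ∀ᶠ i in l, ∀ v, p (s i (π i v)) ∈ ball (p o) r → v ∈ closedBall o R := by
  obtain ⟨R, hR⟩ := hprop (r + 1)
  refine ⟨R, ?_⟩
  filter_upwards [hR, hdist.eventually_abs_sub_lt ((hpb r).insert o) one_pos] with i hi hd v hv
  have hvo := hd _ (mem_insert_of_mem o hv) o (mem_insert _ _)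
  rw [hs] at hvo
  rw [mem_ball] at hv
  refine hi (mem_ball.2 ?_)
  linarith [neg_lt_of_abs_lt hvo]

theorem tendsto_setIntegral_ball_map [ProperSpace E] [MeasurableSpace E] [OpensMeasurableSpace E]
    [∀ i, MeasurableSpace (X i)] [∀ i, OpensMeasurableSpace (X i)] [MeasurableSpace Y]
    [OpensMeasurableSpace Y] [l.IsCountablyGenerated] (m : Measure E)
    [IsFiniteMeasureOnCompacts m] (hdist : PullbackDistTendsto l π p)
    (hprop : UniformlyProper l π o) (hs : ∀ i, Function.RightInverse (s i) (π i))
    (hpb : ∀ r, IsBounded (p ⁻¹' ball (p o) r)) (hπm : ∀ i, Measurable (π i)) (hpm : Measurable p)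
    (hsm : ∀ i, Measurable (s i)) {R : ι → ℝ} (hR : Tendsto R l atTop) {φ : Y → ℝ}
    (hφ : Continuous φ) (hφb : ∃ C, ∀ y, |φ y| ≤ C) (hφs : IsBounded (Function.support φ)) :
    Tendsto (fun i => ∫ a in ball (π i o) (R i), φ (p (s i a)) ∂(m.map (π i))) l
      (𝓝 (∫ y, φ y ∂(m.map p))) := by
  obtain ⟨C, hC⟩ := hφb
  have hC0 : 0 ≤ C := (abs_nonneg _).trans (hC (p o))
  obtain ⟨r, hr⟩ := hφs.subset_ball (p o)
  obtain ⟨L, hL⟩ := exists_eventually_section_mem_imp_mem_closedBall hdist hprop hs hpb r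
  have hfm : ∀ i, Measurable fun a => φ (p (s i a)) := fun i =>
    hφ.measurable.comp (hpm.comp (hsm i))
  have hball : ∀ i, MeasurableSet (π i ⁻¹' ball (π i o) (R i)) := fun i =>
    hπm i measurableSet_ball
  have hpull : ∀ i, ∫ a in ball (π i o) (R i), φ (p (s i a)) ∂(m.map (π i)) =
      ∫ v, (π i ⁻¹' ball (π i o) (R i)).indicator (fun v => φ (p (s i (π i v)))) v ∂m := fun i => by
    rw [setIntegral_map measurableSet_ball (hfm i).aestronglyMeasurable (hπm i).aemeasurable,
      integral_indicator (hball i)]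
  simp only [hpull]
  rw [integral_map hpm.aemeasurable hφ.measurable.aestronglyMeasurable]
  refine tendsto_integral_filter_of_dominated_convergence
    ((closedBall o L).indicator fun _ => C) ?_ ?_ ?_ ?_
  · exact .of_forall fun i => (((hfm i).comp (hπm i)).indicator (hball i)).aestronglyMeasurable
  · filter_upwards [hL] with i hi
    refine .of_forall fun v => (norm_indicator_le_norm_self _ v).trans ?_
    by_cases hv : φ (p (s i (π i v))) = 0
    · rw [hv, norm_zero]
      exact indicator_nonneg (fun _ _ => hC0) _
    · rw [indicator_of_mem (hi v (hr hv))]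
      exact hC _
  · exact (integrable_indicator_iff measurableSet_closedBall).2
      (integrableOn_const measure_closedBall_lt_top.ne)
  · refine .of_forall fun v => ((hφ.tendsto _).comp (tendsto_section hdist hprop hs v)).congr' ?_
    have hv : ∀ᶠ i in l, v ∈ π i ⁻¹' ball (π i o) (R i) := by
      filter_upwards [(hdist.tendsto_dist v o).eventually_lt_const (lt_add_one _),
        hR.eventually_ge_atTop (dist (p v) (p o) + 1)] with i h₁ h₂ using h₁.trans_le h₂
    filter_upwards [hv] with i hi
    exact (indicator_of_mem hi fun v => φ (p (s i (π i v)))).symm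

end PulledBackDistances

theorem exists_tendsto_atTop_of_forall_eventually {p : ℕ → ℕ → Prop} (h0 : ∀ k, p 0 k)
    (h : ∀ n, ∀ᶠ k in atTop, p n k) : ∃ φ : ℕ → ℕ, Tendsto φ atTop atTop ∧ ∀ k, p (φ k) k := by
  choose K hK using fun n => eventually_atTop.1 (h n)
  refine ⟨fun k => Nat.findGreatest (fun n => n = 0 ∨ K n ≤ k) k, ?_, fun k => ?_⟩
  · refine tendsto_atTop.2 fun n => ?_
    filter_upwards [eventually_ge_atTop (max n (K n))] with k hk
    exact Nat.le_findGreatest ((le_max_left _ _).trans hk) (Or.inr ((le_max_right _ _).trans hk))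
  · rcases Nat.findGreatest_spec (P := fun n => n = 0 ∨ K n ≤ k) (Nat.zero_le k) (Or.inl rfl)
      with hzero | hle
    · simp only [hzero, h0]
    · exact hK _ k hle

theorem pointedMeasuredGHTendsto_map {E Y : Type*} {X : ℕ → Type*} [PseudoMetricSpace E]
    [ProperSpace E] [MeasurableSpace E] [OpensMeasurableSpace E] [∀ k, MetricSpace (X k)]
    [∀ k, MeasurableSpace (X k)] [∀ k, OpensMeasurableSpace (X k)] [MetricSpace Y]
    [MeasurableSpace Y] [OpensMeasurableSpace Y] (m : Measure E) [IsFiniteMeasureOnCompacts m]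
    {π : ∀ k, E → X k} {p : E → Y} {s : ∀ k, X k → E} {o : E}
    (hdist : PullbackDistTendsto atTop π p) (hprop : UniformlyProper atTop π o)
    (hπb : ∀ k r, Bornology.IsBounded (π k ⁻¹' Metric.ball (π k o) r))
    (hpb : ∀ r, Bornology.IsBounded (p ⁻¹' Metric.ball (p o) r))
    (hπm : ∀ k, Measurable (π k)) (hpm : Measurable p) (hp : Function.Surjective p)
    (hsm : ∀ k, Measurable (s k)) (hs : ∀ k, Function.RightInverse (s k) (π k))
    (hso : ∀ k, s k (π k o) = o) :
    PointedMeasuredGHTendsto (fun k => m.map (π k)) (fun k => π k o) (m.map p) (p o) := by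
  obtain ⟨n, hn, happrox⟩ := exists_tendsto_atTop_of_forall_eventually (p := fun n k =>
      (∀ a ∈ Metric.ball (π k o) (n : ℝ), ∀ b ∈ Metric.ball (π k o) (n : ℝ),
        |dist (p (s k a)) (p (s k b)) - dist a b| < 1 / ((n : ℝ) + 1)) ∧
      Metric.ball (p o) ((n : ℝ) - 1 / ((n : ℝ) + 1)) ⊆
        Metric.thickening (1 / ((n : ℝ) + 1))
          ((fun a => p (s k a)) '' Metric.ball (π k o) (n : ℝ)))
    (fun k => by simp)
    (fun n => (eventually_abs_dist_section_sub_lt hdist hprop hs n (by positivity)).and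
      (eventually_ball_subset_thickening_image_section hdist hprop hs hp hpb n (by positivity)))
  have hR : Tendsto (fun k => (n k : ℝ)) atTop atTop := tendsto_natCast_atTop_atTop.comp hn
  refine ⟨fun k r => ?_, fun r => ?_, fun k => n k, fun k => 1 / ((n k : ℝ) + 1),
    fun k a => p (s k a), hR, fun k => by positivity,
    tendsto_one_div_add_atTop_nhds_zero_nat.comp hn, fun k => hpm.comp (hsm k),
    fun k => congrArg p (hso k), fun k a ha b hb => ((happrox k).1 a ha b hb).le,
    fun k => (happrox k).2,
    fun φ => tendsto_setIntegral_ball_map m hdist hprop hs hpb hπm hpm hsm hR⟩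
  · rw [Measure.map_apply (hπm k) measurableSet_ball]
    exact (hπb k r).measure_lt_top
  · rw [Measure.map_apply hpm measurableSet_ball]
    exact (hpb r).measure_lt_top

section SetConvergence

open Metric Bornology

variable {ι E : Type*} [PseudoMetricSpace E] {l : Filter ι}

/-- In every bounded region, and up to every error, `S i` is eventually contained in a thickening
of `T i`: one half of the Attouch–Wets convergence of sets. -/
def LocallyNear (l : Filter ι) (S T : ι → Set E) : Prop :=
  ∀ B, IsBounded B → ∀ ε > 0, ∀ᶠ i in l, S i ∩ B ⊆ thickening ε (T i)

/-- Attouch–Wets convergence of sets, the common weakening of the global and of the local Hausdorff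
convergence of smocking sets: within bounded regions the excess of `S i` over `T` and the excess of
`T` over `S i` tend to zero. -/
def AttouchWetsTendsto (S : ι → Set E) (l : Filter ι) (T : Set E) : Prop :=
  LocallyNear l S (fun _ => T) ∧ LocallyNear l (fun _ => T) S

theorem locallyNear_of_tendsto_hausdorffEDist {S T : ι → Set E} {S' T' : ℝ → ι → Set E} (o : E)
    (hS : ∀ R i, S i ∩ closedBall o R ⊆ S' R i) (hT : ∀ R i, T' R i ⊆ T i)
    (h : ∀ R > 0, Tendsto (fun i => hausdorffEDist (S' R i) (T' R i)) l (𝓝 0)) :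
    LocallyNear l S T := by
  intro B hB ε hε
  obtain ⟨R, hR, hBR⟩ := hB.subset_closedBall_lt 0 o
  filter_upwards [(h R hR).eventually_lt_const (ENNReal.ofReal_pos.2 hε)] with i hi z hz
  obtain ⟨z', hz', hzz'⟩ := exists_edist_lt_of_hausdorffEDist_lt (hS R i ⟨hz.1, hBR hz.2⟩) hi
  exact mem_thickening_iff.2 ⟨z', hT R i hz', edist_lt_ofReal.1 hzz'⟩

theorem attouchWetsTendsto_of_tendsto_hausdorffEDist {S : ι → Set E} {T : Set E}
    {S' : ℝ → ι → Set E} {T' : ℝ → Set E} (o : E)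
    (hSS' : ∀ R i, S i ∩ closedBall o R ⊆ S' R i) (hS'S : ∀ R i, S' R i ⊆ S i)
    (hTT' : ∀ R, T ∩ closedBall o R ⊆ T' R) (hT'T : ∀ R, T' R ⊆ T)
    (h : ∀ R > 0, Tendsto (fun i => hausdorffEDist (S' R i) (T' R)) l (𝓝 0)) :
    AttouchWetsTendsto S l T :=
  ⟨locallyNear_of_tendsto_hausdorffEDist o hSS' (fun R _ => hT'T R) h,
    locallyNear_of_tendsto_hausdorffEDist o (fun R _ => hTT' R) hS'S fun R hR => by
      simpa only [hausdorffEDist_comm] using h R hR⟩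

end SetConvergence

theorem measurable_of_rightInverse {E X : Type*} [TopologicalSpace E] [PolishSpace E]
    [MeasurableSpace E] [BorelSpace E] [TopologicalSpace X] [T2Space X] [MeasurableSpace X]
    [OpensMeasurableSpace X] {π : E → X} (hπ : Continuous π) {S : Set E} (hS : MeasurableSet S)
    (hcount : (π '' S).Countable) (hfib : ∀ v ∉ S, ∀ w, π w = π v → w = v) {s : X → E}
    (hs : Function.RightInverse s π) : Measurable s := by
  intro U hU
  have hforced : ∀ v ∉ S, s (π v) = v := fun v hv => hfib v hv _ (hs _)
  have hinj : Set.InjOn π (U ∩ Sᶜ) := fun v hv w _ h => (hfib v hv.2 w h.symm).symm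
  have hpre : s ⁻¹' U = π '' (U ∩ Sᶜ) ∪ (s ⁻¹' U ∩ π '' S) := by
    ext x
    constructor
    · intro hx
      by_cases hxS : s x ∈ S
      · exact Or.inr ⟨hx, s x, hxS, hs x⟩
      · exact Or.inl ⟨s x, ⟨hx, hxS⟩, hs x⟩
    · rintro (⟨v, ⟨hv, hvS⟩, rfl⟩ | ⟨hx, -⟩)
      · rwa [Set.mem_preimage, hforced v hvS]
      · exact hx
  rw [hpre]
  exact ((hU.inter hS.compl).image_of_continuousOn_injOn hπ.continuousOn hinj).union
    (hcount.mono Set.inter_subset_right).measurableSet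

namespace SmockingPattern

open Metric Bornology

variable {ι : Type*} {N : ℕ} {l : Filter ι} {P Q : SmockingPattern N} {A B : ι → SmockingPattern N}
  {I J : Set (EuclideanSpace ℝ (Fin N))} {R δ : ℝ}

/-- The separation factor of the stitches that meet the closed ball of radius `R` about the origin
is at least `δ`. -/
def SeparatedWithin (P : SmockingPattern N) (R δ : ℝ) : Prop :=
  ∀ I ∈ P.stitchesMeeting R, ∀ I' ∈ P.stitchesMeeting R, I ≠ I' → ∀ z ∈ I, ∀ z' ∈ I', δ ≤ dist z z'

/-- A family of patterns has, in every ball, a separation factor that is eventually bounded below by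
a positive constant; the constant may depend on the ball. -/
def LocallySeparated (l : Filter ι) (A : ι → SmockingPattern N) : Prop :=
  ∀ R, ∃ δ > 0, ∀ᶠ i in l, (A i).SeparatedWithin R δ

/-- The stitches of a family of patterns that meet a given ball eventually lie in a common, larger
ball. -/
def LocallyBounded (l : Filter ι) (A : ι → SmockingPattern N) : Prop :=
  ∀ R, ∃ L, ∀ᶠ i in l, ⋃₀ (A i).stitchesMeeting R ⊆ closedBall 0 L

/-- In every ball, and up to every error, each stitch of `A i` is eventually contained in a
thickening of a single stitch of `B i`. -/
def StitchesNear (l : Filter ι) (A B : ι → SmockingPattern N) : Prop :=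
  ∀ R, ∀ ε > 0, ∀ᶠ i in l, ∀ I ∈ (A i).stitchesMeeting R, ∃ J ∈ (B i).stitches, I ⊆ thickening ε J

theorem mem_stitchesMeeting (hI : I ∈ P.stitches) {z : EuclideanSpace ℝ (Fin N)} (hz : z ∈ I)
    (hR : z ∈ closedBall 0 R) : I ∈ P.stitchesMeeting R :=
  ⟨hI, z, hz, hR⟩

theorem mem_stitchesMeeting_add (hI : I ∈ P.stitches) {y z : EuclideanSpace ℝ (Fin N)} {r : ℝ}
    (hy : y ∈ I) (hz : z ∈ closedBall 0 R) (hzy : dist z y ≤ r) : I ∈ P.stitchesMeeting (R + r) :=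
  mem_stitchesMeeting hI hy <| mem_closedBall.2 <| by
    linarith [dist_triangle_left y 0 z, mem_closedBall.1 hz]

theorem smockingSet_inter_closedBall_subset (P : SmockingPattern N) (R : ℝ) :
    P.smockingSet ∩ closedBall 0 R ⊆ ⋃₀ P.stitchesMeeting R := by
  rintro z ⟨⟨I, hI, hz⟩, hzR⟩
  exact ⟨I, mem_stitchesMeeting hI hz hzR, hz⟩

theorem sUnion_stitchesMeeting_subset (P : SmockingPattern N) (R : ℝ) :
    ⋃₀ P.stitchesMeeting R ⊆ P.smockingSet :=
  Set.sUnion_subset_sUnion fun _ hI => hI.1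

theorem stitchesMeeting_mono (P : SmockingPattern N) : Monotone P.stitchesMeeting :=
  fun _ _ h _ hI =>
    ⟨hI.1, hI.2.mono (Set.inter_subset_inter_right _ (closedBall_subset_closedBall h))⟩

theorem SeparatedWithin.anti {R' : ℝ} (h : P.SeparatedWithin R' δ) (hR : R ≤ R') :
    P.SeparatedWithin R δ :=
  fun I hI I' hI' => h I (P.stitchesMeeting_mono hR hI) I' (P.stitchesMeeting_mono hR hI')

theorem exists_separatedWithin (P : SmockingPattern N) : ∃ δ > 0, ∀ R, P.SeparatedWithin R δ := by
  obtain ⟨δ, hδ, hsep⟩ := P.separated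
  exact ⟨δ, hδ, fun R I hI I' hI' => hsep I hI.1 I' hI'.1⟩

theorem locallySeparated_const (P : SmockingPattern N) : LocallySeparated l fun _ => P := by
  obtain ⟨δ, hδ, hsep⟩ := P.exists_separatedWithin
  exact fun R => ⟨δ, hδ, .of_forall fun _ => hsep R⟩

theorem locallySeparated_of_localUniformBounds {P : ℕ → SmockingPattern N}
    (h : LocalUniformBounds P) : LocallySeparated atTop P := by
  intro R
  obtain ⟨L, δ, hδ, K, hK⟩ := h (max R 1) (by positivity)
  refine ⟨δ, hδ, ?_⟩
  filter_upwards [eventually_ge_atTop K] with k hk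
  exact SeparatedWithin.anti (hK k hk).2 (le_max_left R 1)

theorem attouchWetsTendsto_smockingSet {P : ℕ → SmockingPattern N}
    (h : HausdorffTendsto P Q ∨ LocallyHausdorffTendsto P Q) :
    AttouchWetsTendsto (fun k => (P k).smockingSet) atTop Q.smockingSet := by
  rcases h with hglobal | hlocal
  · exact attouchWetsTendsto_of_tendsto_hausdorffEDist (S' := fun _ k => (P k).smockingSet)
      (T' := fun _ => Q.smockingSet) 0 (fun _ _ => Set.inter_subset_left) (fun _ _ => subset_rfl)
      (fun _ => Set.inter_subset_left) (fun _ => subset_rfl) fun _ _ => hglobal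
  · exact attouchWetsTendsto_of_tendsto_hausdorffEDist 0
      (fun R k => (P k).smockingSet_inter_closedBall_subset R)
      (fun R k => (P k).sUnion_stitchesMeeting_subset R) Q.smockingSet_inter_closedBall_subset
      Q.sUnion_stitchesMeeting_subset hlocal

theorem finite_stitchesMeeting (P : SmockingPattern N) (R : ℝ) : (P.stitchesMeeting R).Finite := by
  obtain ⟨δ, hδ, hsep⟩ := P.separated
  obtain ⟨t, -, ht, hcover⟩ :=
    (isCompact_closedBall (0 : EuclideanSpace ℝ (Fin N)) R).finite_cover_balls (half_pos hδ)
  have hsubsingleton : ∀ c, {I ∈ P.stitches | (I ∩ ball c (δ / 2)).Nonempty}.Subsingleton := by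
    rintro c I ⟨hI, z, hz, hzc⟩ I' ⟨hI', z', hz', hzc'⟩
    by_contra hne
    have hgap := hsep I hI I' hI' hne z hz z' hz'
    have htri := dist_triangle_right z z' c
    rw [mem_ball] at hzc hzc'
    linarith
  refine (ht.biUnion fun c _ => (hsubsingleton c).finite).subset ?_
  rintro I ⟨hI, y, hy, hyR⟩
  obtain ⟨c, hc, hyc⟩ := Set.mem_iUnion₂.1 (hcover hyR)
  exact Set.mem_biUnion hc ⟨hI, y, hy, hyc⟩

theorem isBounded_sUnion_stitchesMeeting (P : SmockingPattern N) (R : ℝ) :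
    IsBounded (⋃₀ P.stitchesMeeting R) :=
  (isBounded_sUnion (P.finite_stitchesMeeting R)).2 fun I hI => (P.isCompact I hI.1).isBounded

theorem locallyBounded_const (P : SmockingPattern N) : LocallyBounded l fun _ => P := fun R =>
  ((P.isBounded_sUnion_stitchesMeeting R).subset_closedBall 0).imp fun _ h => .of_forall fun _ => h

theorem subset_thickening_of_isPreconnected {η : ℝ} (hI : IsPreconnected I) (hJ : J ∈ Q.stitches)
    (hIJ : (I ∩ thickening η J).Nonempty) (hJR : thickening η J ⊆ closedBall 0 R)
    (hnear : I ∩ closedBall 0 R ⊆ thickening η Q.smockingSet) (hsep : Q.SeparatedWithin (R + η) δ)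
    (hηδ : 2 * η ≤ δ) : I ⊆ thickening η J := by
  refine hI.subset_of_closure_inter_subset isOpen_thickening hIJ ?_
  rintro z ⟨hzJ, hzI⟩
  have hzR : z ∈ closedBall 0 R := closure_minimal hJR isClosed_closedBall hzJ
  obtain ⟨y', ⟨J', hJ', hy'⟩, hzy'⟩ := mem_thickening_iff.1 (hnear ⟨hzI, hzR⟩)
  have hη : 0 < η := dist_nonneg.trans_lt hzy'
  have hzJ := closure_thickening_subset_cthickening η J hzJ
  rw [(Q.isCompact J hJ).cthickening_eq_biUnion_closedBall hη.le] at hzJ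
  obtain ⟨y, hy, hzy⟩ := Set.mem_iUnion₂.1 hzJ
  suffices J = J' from this ▸ mem_thickening_iff.2 ⟨y', hy', hzy'⟩
  by_contra hne
  have hgap := hsep J (mem_stitchesMeeting_add hJ hy hzR hzy) J'
    (mem_stitchesMeeting_add hJ' hy' hzR hzy'.le) hne y hy y' hy'
  rw [mem_closedBall] at hzy
  linarith [dist_triangle_left y y' z]

theorem StitchesNear.of_locallyNear
    (h : LocallyNear l (fun i => (A i).smockingSet) fun i => (B i).smockingSet)
    (hsep : LocallySeparated l B) (hB : LocallyBounded l B) : StitchesNear l A B := by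
  intro R ε hε
  obtain ⟨L, hL⟩ := hB (R + 1)
  set R' := max R (L + 1)
  obtain ⟨δ, hδ, hδB⟩ := hsep (R' + 1)
  obtain ⟨η, hη, hηε, hη1, hηδ⟩ : ∃ η > 0, η ≤ ε ∧ η ≤ 1 ∧ 2 * η ≤ δ :=
    ⟨min ε (min 1 (δ / 2)), by positivity, min_le_left _ _, by simp,
      by linarith [min_le_right ε (min 1 (δ / 2)), min_le_right 1 (δ / 2)]⟩
  filter_upwards [hL, hδB, h _ (isBounded_closedBall (x := 0) (r := R')) η hη]
    with i hL hδB hnear I ⟨hI, z, hz, hzR⟩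
  have hzR' : z ∈ closedBall 0 R' := closedBall_subset_closedBall (le_max_left _ _) hzR
  obtain ⟨y, ⟨J, hJ, hy⟩, hzy⟩ := mem_thickening_iff.1 (hnear ⟨⟨I, hI, hz⟩, hzR'⟩)
  have hJL : J ⊆ closedBall 0 L := (Set.subset_sUnion_of_mem
    (mem_stitchesMeeting_add hJ hy hzR (hzy.le.trans hη1))).trans hL
  have hJR' : thickening η J ⊆ closedBall 0 R' := by
    intro x hx
    obtain ⟨u, hu, hxu⟩ := mem_thickening_iff.1 hx
    have hu := mem_closedBall.1 (hJL hu)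
    rw [mem_closedBall]
    linarith [dist_triangle x u 0, le_max_right R (L + 1)]
  refine ⟨J, hJ, (subset_thickening_of_isPreconnected ((A i).isConnected I hI).isPreconnected hJ
    ⟨z, hz, mem_thickening_iff.2 ⟨y, hy, hzy⟩⟩ hJR' (fun x hx => hnear ⟨⟨I, hI, hx.1⟩, hx.2⟩)
    (hδB.anti (by linarith)) hηδ).trans (thickening_mono hηε J)⟩

theorem StitchesNear.locallyBounded (h : StitchesNear l A B) (hB : LocallyBounded l B) :
    LocallyBounded l A := by
  intro R
  obtain ⟨L, hL⟩ := hB (R + 1)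
  refine ⟨L + 1, ?_⟩
  filter_upwards [hL, h R 1 one_pos] with i hL hnear w ⟨I, hI, hw⟩
  obtain ⟨J, hJ, hIJ⟩ := hnear I hI
  obtain ⟨-, z, hz, hzR⟩ := hI
  obtain ⟨y, hy, hzy⟩ := mem_thickening_iff.1 (hIJ hz)
  obtain ⟨x, hx, hwx⟩ := mem_thickening_iff.1 (hIJ hw)
  have hxL := mem_closedBall.1 (hL ⟨J, mem_stitchesMeeting_add hJ hy hzR hzy.le, hx⟩)
  rw [mem_closedBall]
  linarith [dist_triangle w x 0]

theorem dist_proj_le (P : SmockingPattern N) (v w : EuclideanSpace ℝ (Fin N)) :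
    dist (P.proj v) (P.proj w) ≤ dist v w :=
  P.smockedDist_le v w [] (by simp)

theorem continuous_proj (P : SmockingPattern N) : Continuous P.proj :=
  (LipschitzWith.of_dist_le_mul (K := 1) fun v w => by simpa using P.dist_proj_le v w).continuous

theorem proj_eq_proj_of_mem (hI : I ∈ P.stitches) {z z' : EuclideanSpace ℝ (Fin N)} (hz : z ∈ I)
    (hz' : z' ∈ I) : P.proj z = P.proj z' :=
  P.proj_eq_iff.2 (Or.inr ⟨I, hI, hz, hz'⟩)

theorem dist_proj_lt_of_mem_thickening {ε : ℝ} (hJ : J ∈ P.stitches)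
    {z z' : EuclideanSpace ℝ (Fin N)} (hz : z ∈ thickening ε J) (hz' : z' ∈ thickening ε J) :
    dist (P.proj z) (P.proj z') < 2 * ε := by
  obtain ⟨y, hy, hzy⟩ := mem_thickening_iff.1 hz
  obtain ⟨y', hy', hzy'⟩ := mem_thickening_iff.1 hz'
  calc dist (P.proj z) (P.proj z')
      ≤ dist (P.proj z) (P.proj y) + dist (P.proj z') (P.proj y) := dist_triangle_right _ _ _
    _ = dist (P.proj z) (P.proj y) + dist (P.proj z') (P.proj y') := by
      rw [proj_eq_proj_of_mem hJ hy hy']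
    _ ≤ dist z y + dist z' y' := add_le_add (P.dist_proj_le _ _) (P.dist_proj_le _ _)
    _ < 2 * ε := by linarith

theorem exists_chainLength_eq_zero {v v' : EuclideanSpace ℝ (Fin N)} (h : P.proj v = P.proj v') :
    ∃ c : List (Hop N), (∀ g ∈ c, g.1 ∈ P.stitches ∧ g.2.1 ∈ g.1 ∧ g.2.2 ∈ g.1) ∧
      chainLength v' v c = 0 := by
  rcases P.proj_eq_iff.1 h with rfl | ⟨I, hI, hv, hv'⟩
  · exact ⟨[], by simp, dist_self v⟩
  · exact ⟨[(I, v, v')], by simp [hI, hv, hv'], by simp [chainLength]⟩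

theorem exists_isHopChain_chainLength_lt {v w : EuclideanSpace ℝ (Fin N)} {r : ℝ}
    (hr : dist (P.proj v) (P.proj w) < r) : ∃ c, P.IsHopChain c ∧ chainLength w v c < r := by
  obtain ⟨ℓ, ⟨v', w', hv, hw, c, hc, rfl⟩, hlt⟩ :=
    exists_lt_of_csInf_lt (P.chainLengths_nonempty _ _) hr
  obtain ⟨cv, hcv, hv0⟩ := exists_chainLength_eq_zero hv.symm
  obtain ⟨cw, hcw, hw0⟩ := exists_chainLength_eq_zero hw
  obtain ⟨c', hc', hle⟩ := P.exists_isHopChain w (cv ++ (c ++ cw)) (by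
    simp only [List.mem_append]
    rintro g (hg | hg | hg)
    exacts [hcv g hg, hc.1 g hg, hcw g hg]) v
  refine ⟨c', hc', ?_⟩
  have h₁ := chainLength_append w v' (c ++ cw) cv v
  have h₂ := chainLength_append w w' cw c v'
  linarith

theorem IsHopChain.tail {h : Hop N} {c : List (Hop N)} (hc : P.IsHopChain (h :: c)) :
    P.IsHopChain c :=
  ⟨fun g hg => hc.1 g (List.mem_cons_of_mem h hg), hc.2.tail⟩

section Comparison

variable {Y : Type*} [PseudoMetricSpace Y] {f : EuclideanSpace ℝ (Fin N) → Y} {b : Y} {T η κ : ℝ}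

/-- Each gap between consecutive stitches, being at least `δ` long, pays for the error `η ≤ κ * δ`
made in the stitch that follows it, so the number of stitches does not enter. -/
theorem dist_le_chainLength_of_isHopChain_cons (hf : ∀ v w, dist (f v) (f w) ≤ dist v w)
    (hfb : f ⁻¹' closedBall b T ⊆ closedBall 0 R) (hsep : P.SeparatedWithin R δ)
    (hfI : ∀ I ∈ P.stitchesMeeting R, ∀ z ∈ I, ∀ z' ∈ I, dist (f z) (f z') ≤ η) (hκ : 0 ≤ κ)
    (hη : η ≤ κ * δ) (w : EuclideanSpace ℝ (Fin N)) (c : List (Hop N)) :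
    ∀ h : Hop N, P.IsHopChain (h :: c) →
      dist (f h.2.2) b + (1 + κ) * chainLength w h.2.2 c ≤ T →
      dist (f h.2.2) (f w) ≤ (1 + κ) * chainLength w h.2.2 c := by
  induction c with
  | nil =>
    intro h _ _
    exact (hf _ _).trans (le_mul_of_one_le_left dist_nonneg (by linarith))
  | cons g c ih =>
    intro h hc hT
    simp only [chainLength] at hT ⊢
    obtain ⟨hI, -, hz⟩ := hc.1 h (by simp)
    obtain ⟨hJ, hy, hy'⟩ := hc.1 g (by simp)
    have hlen : 0 ≤ (1 + κ) * chainLength w g.2.2 c :=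
      mul_nonneg (by linarith) (chainLength_nonneg w c _)
    have hgap_nonneg : 0 ≤ κ * dist h.2.2 g.2.1 := mul_nonneg hκ dist_nonneg
    have hfgap := hf h.2.2 g.2.1
    have hzR : h.2.2 ∈ closedBall 0 R := hfb <| mem_closedBall.2 <| by
      linarith [dist_nonneg (x := h.2.2) (y := g.2.1)]
    have hyR : g.2.1 ∈ closedBall 0 R := hfb <| mem_closedBall.2 <| by
      linarith [dist_triangle_left (f g.2.1) b (f h.2.2)]
    have hJR := mem_stitchesMeeting hJ hy hyR
    have hgap : δ ≤ dist h.2.2 g.2.1 := hsep h.1 (mem_stitchesMeeting hI hz hzR) g.1 hJR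
      (List.isChain_cons_cons.1 hc.2).1 _ hz _ hy
    have hpay : dist (f g.2.1) (f g.2.2) ≤ κ * dist h.2.2 g.2.1 :=
      (hfI g.1 hJR _ hy _ hy').trans (hη.trans (mul_le_mul_of_nonneg_left hgap hκ))
    have hhop := dist_triangle (f h.2.2) (f g.2.1) (f g.2.2)
    have hrest := ih g hc.tail (by linarith [dist_triangle_left (f g.2.2) b (f h.2.2)])
    linarith [dist_triangle (f h.2.2) (f g.2.2) (f w)]

theorem dist_le_of_dist_proj_lt (hf : ∀ v w, dist (f v) (f w) ≤ dist v w)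
    (hfb : f ⁻¹' closedBall b T ⊆ closedBall 0 R) (hsep : P.SeparatedWithin R δ)
    (hfI : ∀ I ∈ P.stitchesMeeting R, ∀ z ∈ I, ∀ z' ∈ I, dist (f z) (f z') ≤ η) (hκ : 0 ≤ κ)
    (hη₀ : 0 ≤ η) (hη : η ≤ κ * δ) {v w : EuclideanSpace ℝ (Fin N)} {r : ℝ}
    (hr : dist (P.proj v) (P.proj w) < r) (hT : dist (f v) b + (1 + κ) * r + η ≤ T) :
    dist (f v) (f w) ≤ (1 + κ) * r + η := by
  obtain ⟨c, hc, hcr⟩ := exists_isHopChain_chainLength_lt hr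
  suffices dist (f v) (f w) ≤ (1 + κ) * chainLength w v c + η from
    this.trans (by gcongr)
  have hcT : dist (f v) b + (1 + κ) * chainLength w v c + η ≤ T := le_trans (by gcongr) hT
  cases c with
  | nil =>
    have := le_mul_of_one_le_left (dist_nonneg (x := v) (y := w)) (show 1 ≤ 1 + κ by linarith)
    exact (hf v w).trans (this.trans (le_add_of_nonneg_right hη₀))
  | cons h c =>
    simp only [chainLength] at hcT ⊢
    obtain ⟨hI, hz, hz'⟩ := hc.1 h (by simp)
    have hlen : 0 ≤ (1 + κ) * chainLength w h.2.2 c :=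
      mul_nonneg (by linarith) (chainLength_nonneg w c _)
    have hgap_nonneg : 0 ≤ κ * dist v h.2.1 := mul_nonneg hκ dist_nonneg
    have hfgap := hf v h.2.1
    have hzR : h.2.1 ∈ closedBall 0 R := hfb <| mem_closedBall.2 <| by
      linarith [dist_triangle_left (f h.2.1) b (f v)]
    have hhop := hfI h.1 (mem_stitchesMeeting hI hz hzR) _ hz _ hz'
    have hentry := dist_triangle (f v) (f h.2.1) (f h.2.2)
    have hrest := dist_le_chainLength_of_isHopChain_cons hf hfb hsep hfI hκ hη w c h hc
      (by linarith [dist_triangle_left (f h.2.2) b (f v)])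
    linarith [dist_triangle (f v) (f h.2.2) (f w)]

end Comparison

theorem StitchesNear.dist_proj_le_add (h : StitchesNear l A B) (hsep : LocallySeparated l A)
    (hB : UniformlyProper l (fun i => (B i).proj) 0) (T : ℝ) {ε : ℝ} (hε : 0 < ε) :
    ∀ᶠ i in l, ∀ v w,
      dist ((B i).proj v) ((B i).proj 0) + dist ((A i).proj v) ((A i).proj w) ≤ T →
        dist ((B i).proj v) ((B i).proj w) ≤ dist ((A i).proj v) ((A i).proj w) + ε := by
  obtain ⟨R, hR⟩ := hB (T + ε + 1)
  obtain ⟨δ, hδ, hδA⟩ := hsep R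
  obtain ⟨κ, hκ, hκε⟩ : ∃ κ > 0, κ * (|T| + ε) ≤ ε / 3 :=
    ⟨ε / 3 / (|T| + ε), by positivity, (div_mul_cancel₀ _ (by positivity)).le⟩
  obtain ⟨η, hη, hηε, hηδ⟩ : ∃ η > 0, η ≤ ε / 3 ∧ η ≤ κ * δ :=
    ⟨min (ε / 3) (κ * δ), by positivity, min_le_left _ _, min_le_right _ _⟩
  filter_upwards [hR, hδA, h R (η / 2) (half_pos hη)] with i hR hδA hnear v w hvw
  have hfb : (B i).proj ⁻¹' closedBall ((B i).proj 0) (T + ε) ⊆ closedBall 0 R :=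
    (Set.preimage_mono (closedBall_subset_ball (lt_add_one _))).trans hR
  have hfI : ∀ I ∈ (A i).stitchesMeeting R, ∀ z ∈ I, ∀ z' ∈ I,
      dist ((B i).proj z) ((B i).proj z') ≤ η := fun I hI z hz z' hz' => by
    obtain ⟨J, hJ, hIJ⟩ := hnear I hI
    linarith [dist_proj_lt_of_mem_thickening hJ (hIJ hz) (hIJ hz')]
  set d := dist ((A i).proj v) ((A i).proj w)
  have hκd : κ * (d + ε / 3) ≤ ε / 3 := by
    refine (mul_le_mul_of_nonneg_left ?_ hκ.le).trans hκε
    linarith [le_abs_self T, dist_nonneg (x := (B i).proj v) (y := (B i).proj 0)]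
  have hbound := dist_le_of_dist_proj_lt (B i).dist_proj_le hfb hδA hfI hκ.le hη.le hηδ
    (r := d + ε / 3) (v := v) (w := w) (lt_add_of_pos_right _ (by positivity)) (by linarith)
  linarith

theorem StitchesNear.uniformlyProper (h : StitchesNear l A B) (hsep : LocallySeparated l A)
    (hB : UniformlyProper l (fun i => (B i).proj) 0) :
    UniformlyProper l (fun i => (A i).proj) 0 := by
  intro r
  obtain ⟨R, hR⟩ := hB (r + 1)
  refine ⟨R, ?_⟩
  filter_upwards [hR, h.dist_proj_le_add hsep hB r one_pos] with i hR hle w hw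
  rw [Set.mem_preimage, mem_ball, dist_comm] at hw
  refine hR (mem_ball'.2 ?_)
  linarith [hle 0 w (by rw [dist_self]; linarith)]

theorem exists_closedBall_of_isHopChain_of_chainLength_lt (hδ : ∀ R, P.SeparatedWithin R δ)
    (n : ℕ) : ∀ R, ∃ R', ∀ h c w, P.IsHopChain (h :: c) → h.2.1 ∈ closedBall 0 R →
      chainLength w h.2.2 c < n * δ → w ∈ closedBall 0 R' := by
  induction n with
  | zero =>
    refine fun R => ⟨0, fun h c w _ _ hlt => ?_⟩
    rw [Nat.cast_zero, zero_mul] at hlt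
    exact absurd (chainLength_nonneg w c _) hlt.not_ge
  | succ n ih =>
    intro R
    obtain ⟨L, hL⟩ := (P.isBounded_sUnion_stitchesMeeting R).subset_closedBall 0
    obtain ⟨R', hR'⟩ := ih (L + (n + 1 : ℕ) * δ)
    refine ⟨max (L + (n + 1 : ℕ) * δ) R', fun h c w hc hz hlt => ?_⟩
    obtain ⟨hI, hzI, hzI'⟩ := hc.1 h (by simp)
    have hzL := mem_closedBall.1 (hL ⟨h.1, mem_stitchesMeeting hI hzI hz, hzI'⟩)
    cases c with
    | nil =>
      simp only [chainLength] at hlt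
      refine closedBall_subset_closedBall (le_max_left _ _) (mem_closedBall.2 ?_)
      linarith [dist_triangle_left w 0 h.2.2]
    | cons g c =>
      obtain ⟨hJ, hyJ, -⟩ := hc.1 g (by simp)
      simp only [chainLength] at hlt
      have hgap : δ ≤ dist h.2.2 g.2.1 := by
        refine hδ (max (dist h.2.2 0) (dist g.2.1 0)) h.1 (mem_stitchesMeeting hI hzI' ?_) g.1
          (mem_stitchesMeeting hJ hyJ ?_) (List.isChain_cons_cons.1 hc.2).1 _ hzI' _ hyJ
        · exact mem_closedBall.2 (le_max_left _ _)
        · exact mem_closedBall.2 (le_max_right _ _)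
      refine closedBall_subset_closedBall (le_max_right _ _)
        (hR' g c w hc.tail (mem_closedBall.2 ?_) ?_)
      · linarith [dist_triangle_left g.2.1 0 h.2.2, chainLength_nonneg w c g.2.2]
      · push_cast at hlt
        linarith

theorem isBounded_preimage_proj_ball (P : SmockingPattern N) (r : ℝ) :
    IsBounded (P.proj ⁻¹' ball P.basePoint r) := by
  obtain ⟨δ, hδ, hsep⟩ := P.exists_separatedWithin
  obtain ⟨n, hn⟩ := exists_nat_ge (r / δ)
  rw [div_le_iff₀ hδ] at hn
  obtain ⟨R, hR⟩ := exists_closedBall_of_isHopChain_of_chainLength_lt hsep n r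
  refine (isBounded_iff_subset_closedBall 0).2 ⟨max r R, fun w hw => ?_⟩
  obtain ⟨c, hc, hlt⟩ := exists_isHopChain_chainLength_lt (mem_ball'.1 hw)
  cases c with
  | nil => exact closedBall_subset_closedBall (le_max_left _ _) (mem_closedBall'.2 hlt.le)
  | cons h c =>
    simp only [chainLength] at hlt
    refine closedBall_subset_closedBall (le_max_right _ _)
      (hR h c w hc (mem_closedBall'.2 ?_) ?_)
    · linarith [chainLength_nonneg w c h.2.2]
    · linarith [dist_nonneg (x := (0 : EuclideanSpace ℝ (Fin N))) (y := h.2.1)]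

theorem uniformlyProper_const (P : SmockingPattern N) :
    UniformlyProper l (fun _ => P.proj) (0 : EuclideanSpace ℝ (Fin N)) := fun r =>
  ((P.isBounded_preimage_proj_ball r).subset_closedBall 0).imp fun _ h => .of_forall fun _ => h

theorem pullbackDistTendsto_proj (hAQ : StitchesNear l A fun _ => Q)
    (hQA : StitchesNear l (fun _ => Q) A) (hsep : LocallySeparated l A) :
    PullbackDistTendsto l (fun i => (A i).proj) Q.proj := by
  intro S hS
  obtain ⟨R, hR⟩ := hS.subset_closedBall 0
  have hA := hAQ.uniformlyProper hsep Q.uniformlyProper_const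
  refine tendstoUniformlyOn_iff.2 fun ε hε => ?_
  filter_upwards
    [hAQ.dist_proj_le_add hsep Q.uniformlyProper_const (3 * R) (half_pos hε),
    hQA.dist_proj_le_add Q.locallySeparated_const hA (3 * R) (half_pos hε)]
    with i hle hge ⟨v, w⟩ ⟨hv, hw⟩
  have hv := mem_closedBall.1 (hR hv)
  have hw := mem_closedBall.1 (hR hw)
  have hvw := dist_triangle_right v w 0
  have hbase : ∀ P P' : SmockingPattern N,
      dist (P.proj v) (P.proj 0) + dist (P'.proj v) (P'.proj w) ≤ 3 * R := fun P P' => by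
    linarith [P.dist_proj_le v 0, P'.dist_proj_le v w]
  rw [Real.dist_eq, abs_lt]
  constructor <;> linarith [hle v w (hbase _ _), hge v w (hbase _ _)]

theorem exists_measurable_rightInverse_proj (P : SmockingPattern N) :
    ∃ s : P.Space → EuclideanSpace ℝ (Fin N),
      Measurable s ∧ Function.RightInverse s P.proj ∧ s P.basePoint = 0 := by
  classical
  choose t ht using P.exists_rep
  set s := Function.update t P.basePoint 0
  have hs : Function.RightInverse s P.proj := fun x => by
    rcases eq_or_ne x P.basePoint with rfl | hx
    · simp [s, basePoint]
    · simpa [s, Function.update_of_ne hx] using ht x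
  have hS : MeasurableSet P.smockingSet :=
    .sUnion P.countable fun I hI => (P.isCompact I hI).measurableSet
  have hcount : (P.proj '' P.smockingSet).Countable := by
    rw [smockingSet, Set.image_sUnion]
    refine (P.countable.image _).sUnion ?_
    rintro _ ⟨I, hI, rfl⟩
    refine Set.Subsingleton.countable ?_
    rintro _ ⟨v, hv, rfl⟩ _ ⟨w, hw, rfl⟩
    exact proj_eq_proj_of_mem hI hv hw
  have hfib : ∀ v ∉ P.smockingSet, ∀ w, P.proj w = P.proj v → w = v := fun v hv w hwv =>
    (P.proj_eq_iff.1 hwv).resolve_right fun ⟨I, hI, _, hvI⟩ => hv ⟨I, hI, hvI⟩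
  exact ⟨s, measurable_of_rightInverse P.continuous_proj hS hcount hfib hs, hs, by simp [s]⟩

end SmockingPattern

open SmockingPattern in
theorem mainTheorem6_general {N : ℕ} {P : ℕ → SmockingPattern N} {Q : SmockingPattern N}
    (hconv : AttouchWetsTendsto (fun k => (P k).smockingSet) atTop Q.smockingSet)
    (hsep : LocallySeparated atTop P) :
    PointedMeasuredGHTendsto (fun k => (P k).measure) (fun k => (P k).basePoint)
      Q.measure Q.basePoint := by
  have hPQ : StitchesNear atTop P fun _ => Q :=
    .of_locallyNear hconv.1 Q.locallySeparated_const Q.locallyBounded_const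
  have hQP : StitchesNear atTop (fun _ => Q) P :=
    .of_locallyNear hconv.2 hsep (hPQ.locallyBounded Q.locallyBounded_const)
  choose s hsm hs hs0 using fun k => (P k).exists_measurable_rightInverse_proj
  exact pointedMeasuredGHTendsto_map volume (pullbackDistTendsto_proj hPQ hQP hsep)
    (hPQ.uniformlyProper hsep Q.uniformlyProper_const)
    (fun k => (P k).isBounded_preimage_proj_ball) Q.isBounded_preimage_proj_ball
    (fun k => (P k).measurable_proj) Q.measurable_proj Q.exists_rep hsm hs hs0

theorem mainTheorem6 {N : ℕ} (P : ℕ → SmockingPattern N) (Q : SmockingPattern N)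
    (hconv : HausdorffTendsto P Q ∨ LocallyHausdorffTendsto P Q)
    (hbound : LocalUniformBounds P) :
    PointedMeasuredGHTendsto (fun k => (P k).measure) (fun k => (P k).basePoint)
      Q.measure Q.basePoint :=
  mainTheorem6_general (SmockingPattern.attouchWetsTendsto_smockingSet hconv)
    (SmockingPattern.locallySeparated_of_localUniformBounds hbound)
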